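/- Let $G$ be a finite unweighted directed graph with vertex set $V$, and write $u \preceq_d w$ if the directed distance (number of edges) from $u$ to $w$ in $G$ is at most $d$. Let $D_r > 0$ be real and let $P=\langle v_0,\dots,v_\ell\rangle$ be a directed path (or walk) in $G$ with $\ell \le D_r$. For a set $Q$ of vertices of a directed graph $H$ let $R^-_d(H,Q)$ be the set of vertices of $H$ that have distance at most $d$ in $H$ to some vertex of $Q$. Let $\rho_{\min}$ be real and put $R^- = R^-_{\rho_{\min}D_r}(G,P)$. Let $I$ be a finite nonempty set of interval scalars; to each $\sigma\in I$ belongs an interval $[\sigma_{\min},\sigma_{\max})$ with $\sigma_{\min}\ge \rho_{\min}+1$, and these intervals are pairwise disjoint. For every vertex $u$ and every $\sigma\in I$ fix a search scalar $\rho_u(\sigma)\in[\sigma_{\min},\sigma_{\max})$ by an arbitrary rule. Let $0\le t\le |R^-|$ with $|I|\ge 4t$. Choose a set $S\subseteq R^-$ of $t$ pivots uniformly at random, and for each $u\in S$, independently and uniformly, an interval scalar $\sigma_u\in I$; put $\rho_u=\rho_u(\sigma_u)$. For $u\in S$ let $\mathrm{Fringe}(P,u)=\min\{i\le \ell : u\preceq_{\rho_uD_r}v_i\}$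 and let $\mathrm{Core}(P,u)=\min\{j\le \ell : u\preceq_{(\rho_u-1)D_r}v_j\}$. List the pivots as $u_1,\dots,u_t$ in non-decreasing order of $c_i=\mathrm{Core}(P,u_i)$, put $c_0=0$, $c_{t+1}=\ell+1$ and $f_i=\min(\min\{\mathrm{Fringe}(P,u_j): j>i\},\,c_{i+1})$, and define the core subpaths $P_i=\langle v_{c_i},\dots,v_{f_i-1}\rangle$ for $0\le i\le t$ (empty if $f_i\le c_i$). If some $u\in S$ is a bridge, i.e. $u\preceq_{\rho_uD_r}v_i$ and $v_j\preceq_{\rho_uD_r}u$ for some $i,j \le \ell$, then there are no path-relevant subproblems and all $P_i$ are taken to be empty. Each pivot $u\in S$ gives the label $u^{Des}$ to all $x$ with $u\preceq_{\rho_uD_r}x$ and the label $u^{Anc}$ to all $x$ with $x\preceq_{\rho_uD_r}u$. For nonempty $P_i$ let $V_{a_i}$ be the set of all vertices with exactly the same labels as the first vertex $v_{c_i}$ of $P_i$; an empty $P_i$ contributes $0$ below. Then $$\sum_{i=0}^{t}\mathbb E\Bigl[\bigl|R^-_{\rho_{\min}D_r}(G[V_{a_i}],P_i)\bigr|\Bigr]\;\le\;\frac{1.5}{t+1}\,\bigl|R^-_{\rho_{\min}D_r}(G,P)\bigr|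 .$$ -/

import Mathlib

open scoped BigOperators

namespace DirectedHopset

noncomputable section

/-- `p 0, p 1, ..., p n` is a directed walk with `n` edges in `G`
(the values of `p` beyond `n` play no role). -/
def IsWalk {V : Type*} (G : Digraph V) (p : ℕ → V) (n : ℕ) : Prop :=
  ∀ i < n, G.Adj (p i) (p (i + 1))

/-- `x ⪯_d y` in `G`: the directed distance from `x` to `y` (least number of edges of a directed
walk, infinite if there is none) is at most the real number `d`. -/
def Reach {V : Type*} (G : Digraph V) (d : ℝ) (x y : V) : Prop :=
  ∃ (n : ℕ) (p : ℕ → V), (n : ℝ) ≤ d ∧ IsWalk G p n ∧ p 0 = x ∧ p n = y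

/-- The subgraph `G[W]` induced by a set `W` of vertices. -/
def induce {V : Type*} (G : Digraph V) (W : Set V) : Digraph W where
  Adj x y := G.Adj x y

/-- The set `R⁻_d(G, Q)` of `d`-distance ancestors of a set `Q` of vertices. -/
def ancestors {V : Type*} [Finite V] (G : Digraph V) (d : ℝ) (Q : Set V) : Finset V :=
  (Set.toFinite {x | ∃ y ∈ Q, Reach G d x y}).toFinset

/-- The vertices `v 0, ..., v ℓ` of a path. -/
def pathVertices {V : Type*} (v : ℕ → V) (ℓ : ℕ) : Set V := {x | ∃ i ≤ ℓ, x = v i}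

/-- `Fringe(P, u)`, for an ancestor pivot `u` with search scalar `ρ u` and basic search distance
`D`: the least index `i ≤ ℓ` such that `u ⪯_{ρ u * D} v i` (and `ℓ + 1` if there is none). -/
def fringeIdx {V : Type*} (G : Digraph V) (D : ℝ) (v : ℕ → V) (ℓ : ℕ) (ρ : V → ℝ) (u : V) : ℕ :=
  sInf ({i | i ≤ ℓ ∧ Reach G (ρ u * D) u (v i)} ∪ {ℓ + 1})

/-- `Core(P, u)`, for an ancestor pivot `u`: the least index `i ≤ ℓ` such that
`u ⪯_{(ρ u - 1) * D} v i` (and `ℓ + 1` if there is none). -/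
def coreIdx {V : Type*} (G : Digraph V) (D : ℝ) (v : ℕ → V) (ℓ : ℕ) (ρ : V → ℝ) (u : V) : ℕ :=
  sInf ({i | i ≤ ℓ ∧ Reach G ((ρ u - 1) * D) u (v i)} ∪ {ℓ + 1})

/-- The pivot `u` is a bridge of the path: `u ⪯_{ρ u * D} P` and `P ⪯_{ρ u * D} u`. -/
def IsBridge {V : Type*} (G : Digraph V) (D : ℝ) (v : ℕ → V) (ℓ : ℕ) (ρ : V → ℝ) (u : V) : Prop :=
  (∃ i ≤ ℓ, Reach G (ρ u * D) u (v i)) ∧ (∃ i ≤ ℓ, Reach G (ρ u * D) (v i) u)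

/-- The pivots in `S` listed as `u_1, ..., u_t` in non-decreasing order of their core index.
(Ties are broken arbitrarily; `u_j` is the entry with position `j - 1` of the list.) -/
def pivotList {V : Type*} (G : Digraph V) (D : ℝ) (v : ℕ → V) (ℓ : ℕ) (ρ : V → ℝ)
    (S : Finset V) : List V :=
  S.toList.insertionSort (fun u w => coreIdx G D v ℓ ρ u ≤ coreIdx G D v ℓ ρ w)

/-- The indices `c_0 = 0`, `c_i = Core(P, u_i)` for `1 ≤ i ≤ t`, and `c_{t+1} = ℓ + 1`. -/
def cutIdx {V : Type*} (G : Digraph V) (D : ℝ) (v : ℕ → V) (ℓ : ℕ) (ρ : V → ℝ)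
    (S : Finset V) : ℕ → ℕ
  | 0 => 0
  | i + 1 => (((pivotList G D v ℓ ρ S)[i]?).map (coreIdx G D v ℓ ρ)).getD (ℓ + 1)

/-- The indices `f_i = min (min {Fringe(P, u_j) | j > i}, c_{i+1})`. -/
def endIdx {V : Type*} (G : Digraph V) (D : ℝ) (v : ℕ → V) (ℓ : ℕ) (ρ : V → ℝ)
    (S : Finset V) (i : ℕ) : ℕ :=
  (((pivotList G D v ℓ ρ S).drop i).map (fringeIdx G D v ℓ ρ)).foldr min
    (cutIdx G D v ℓ ρ S (i + 1))

/-- The vertex set of the core subpath `P_i = ⟨v_{c_i}, ..., v_{f_i - 1}⟩`, which is empty if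
`f_i ≤ c_i`. If some pivot is a bridge there are no path-relevant subproblems, that is, all the
`P_i` are empty. -/
def coreSubpath {V : Type*} (G : Digraph V) (D : ℝ) (v : ℕ → V) (ℓ : ℕ) (ρ : V → ℝ)
    (S : Finset V) (i : ℕ) : Set V :=
  {x | (∀ u ∈ S, ¬ IsBridge G D v ℓ ρ u) ∧
    ∃ j, cutIdx G D v ℓ ρ S i ≤ j ∧ j < endIdx G D v ℓ ρ S i ∧ x = v j}

/-- `x` and `y` get the same labels. Each pivot `u ∈ S` puts a label `u^Des` on every `x` with
`u ⪯_{ρ u * D} x` and a label `u^Anc` on every `x` with `x ⪯_{ρ u * D} u`. -/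
def SameLabels {V : Type*} (G : Digraph V) (D : ℝ) (ρ : V → ℝ) (S : Finset V) (x y : V) : Prop :=
  ∀ u ∈ S, (Reach G (ρ u * D) u x ↔ Reach G (ρ u * D) u y) ∧
    (Reach G (ρ u * D) x u ↔ Reach G (ρ u * D) y u)

/-- The vertex set `V_{a_i}` of the core subproblem of `P_i`: all vertices with the same labels as
the first vertex `v_{c_i}` of `P_i`. (It only matters for a nonempty `P_i`.) -/
def coreClass {V : Type*} (G : Digraph V) (D : ℝ) (v : ℕ → V) (ℓ : ℕ) (ρ : V → ℝ)
    (S : Finset V) (i : ℕ) : Set V :=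
  {x | SameLabels G D ρ S x (v (cutIdx G D v ℓ ρ S i))}

/-- The number `|R⁻_d(G[V_{a_i}], P_i)|` of `d`-distance ancestors of the core subpath `P_i`,
distances being measured inside the subproblem `G[V_{a_i}]`. -/
def coreAncestorCount {V : Type*} [Finite V] (G : Digraph V) (D : ℝ) (v : ℕ → V) (ℓ : ℕ)
    (ρ : V → ℝ) (S : Finset V) (d : ℝ) (i : ℕ) : ℕ :=
  (ancestors (induce G (coreClass G D v ℓ ρ S i)) d
    (Subtype.val ⁻¹' coreSubpath G D v ℓ ρ S i)).card

end

end DirectedHopset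

/-!
The expectation is bounded by comparing pairs of vertices of `R⁻ = ancestors G (ρmin * D) P`.

A vertex `x` survives if it is a `ρmin * D`-distance ancestor of some core subpath `P_i` inside its
core subproblem. It survives for at most one `i`, because `u_j` separates the classes of `P_i` and
`P_j` for `i < j` (`IsCoreAncestor.index_le`), and it is not a pivot, since it would then be a bridge
(`IsCoreAncestor.notMem`). Survival imposes a condition on every pivot `z` separately
(`IsCoreAncestor.compatible`): `x` does not reach `z` within the search distance of `z`, as `z` would
be a bridge; and if `z` meets the path (within distance `ρmin * D`) no later than `x`, then `z`
reaches `x`, as it reaches the first vertex of `P_i`. This condition `Compatible` on `x` and `z`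
involves the random scalar of `z` only. Let `p x z` be its probability. If `x` meets the path no later
than `z`, the conditions for `(x, z)` and for `(z, x)` say that the distance from `x` to `z` is more
than the search distance of `z`, and at most that of `x`. The two scalars have the same distribution
up to their position in the interval, and the intervals are disjoint, so
`p x z + p z x ≤ 1 + 1 / |I|` (`card_compatible_add_card_compatible_le`).

By independence, the expected number of survivors is at most the average over `S` of
`∑ x ∈ R⁻ \ S, ∏ z ∈ S, p x z`. Putting `T = S ∪ {x}`, this becomes a sum over the `(t + 1)`-subsets
`T` of `R⁻` of `∑ x ∈ T, ∏ z ∈ T \ {x}, p x z`, which is at most `(1 + 1 / |I|) ^ t`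
(`sum_prod_erase_le_pow`): a tournament has at most one vertex that beats all others. Finally
`(1 + 1 / |I|) ^ t ≤ exp (1 / 4) ≤ 1.5`, and there are at most `|R⁻| / (t + 1)` times as many
`(t + 1)`-subsets as `t`-subsets.
-/

namespace DirectedHopset

/-! ### Walks and distances -/

section Reach

variable {V : Type*} {G : Digraph V}

lemma Reach.mono {d e : ℝ} {x y : V} (h : Reach G d x y) (hde : d ≤ e) : Reach G e x y := by
  obtain ⟨n, p, hn, hp⟩ := h
  exact ⟨n, p, hn.trans hde, hp⟩

lemma Reach.refl {d : ℝ} (hd : 0 ≤ d) (x : V) : Reach G d x x :=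
  ⟨0, fun _ => x, by simpa using hd, fun i hi => absurd hi (Nat.not_lt_zero i), rfl, rfl⟩

lemma Reach.nonneg {d : ℝ} {x y : V} (h : Reach G d x y) : 0 ≤ d := by
  obtain ⟨n, -, hn, -⟩ := h
  exact n.cast_nonneg.trans hn

lemma Reach.trans {d e : ℝ} {x y z : V} (hxy : Reach G d x y) (hyz : Reach G e y z) :
    Reach G (d + e) x z := by
  obtain ⟨n, p, hn, hp, rfl, rfl⟩ := hxy
  obtain ⟨m, q, hm, hq, hq0, rfl⟩ := hyz
  refine ⟨n + m, fun i => if i ≤ n then p i else q (i - n), by push_cast; linarith, ?_, by simp, ?_⟩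
  · intro i hi
    rcases lt_trichotomy i n with h | rfl | h
    · simpa [h.le, Nat.succ_le_of_lt h] using hp i h
    · simpa [hq0] using hq 0 (by omega)
    · have := hq (i - n) (by omega)
      rw [show i - n + 1 = i + 1 - n by omega] at this
      simpa [show ¬ i ≤ n by omega, show ¬ i + 1 ≤ n by omega] using this
  · rcases Nat.eq_zero_or_pos m with rfl | h
    · simp [hq0]
    · simp [show ¬ n + m ≤ n by omega]

/-- The vertices of a walk reach the later ones within its length. -/
lemma IsWalk.reach {v : ℕ → V} {ℓ i j : ℕ} (hv : IsWalk G v ℓ) (hij : i ≤ j) (hj : j ≤ ℓ) :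
    Reach G (ℓ : ℝ) (v i) (v j) :=
  ⟨j - i, fun k => v (i + k), by exact_mod_cast (Nat.sub_le j i).trans hj,
    fun k hk => hv (i + k) (by omega), rfl, by simp [hij]⟩

lemma Reach.of_induce {W : Set V} {d : ℝ} {x y : W} (h : Reach (induce G W) d x y) :
    Reach G d (x : V) (y : V) := by
  obtain ⟨n, p, hn, hp, rfl, rfl⟩ := h
  exact ⟨n, fun i => p i, hn, fun i hi => hp i hi, rfl, rfl⟩

lemma mem_ancestors [Finite V] {d : ℝ} {Q : Set V} {x : V} :
    x ∈ ancestors G d Q ↔ ∃ y ∈ Q, Reach G d x y := by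
  simp [ancestors]

end Reach

/-! ### The first vertex of a path within a given distance -/

section FirstIdx

variable {V : Type*} {G : Digraph V} {v : ℕ → V} {ℓ : ℕ}

/-- The least index `i ≤ ℓ` such that `u ⪯_d v i`, and `ℓ + 1` if there is none. Both
`fringeIdx` and `coreIdx` are instances of it. -/
noncomputable def firstIdx (G : Digraph V) (d : ℝ) (v : ℕ → V) (ℓ : ℕ) (u : V) : ℕ :=
  sInf ({i | i ≤ ℓ ∧ Reach G d u (v i)} ∪ {ℓ + 1})

lemma firstIdx_le {d : ℝ} {u : V} {i : ℕ} (hi : i ≤ ℓ) (h : Reach G d u (v i)) :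
    firstIdx G d v ℓ u ≤ i :=
  Nat.sInf_le (Or.inl ⟨hi, h⟩)

lemma firstIdx_le_succ (d : ℝ) (u : V) : firstIdx G d v ℓ u ≤ ℓ + 1 :=
  Nat.sInf_le (Or.inr rfl)

lemma reach_firstIdx {d : ℝ} {u : V} (h : firstIdx G d v ℓ u ≤ ℓ) :
    Reach G d u (v (firstIdx G d v ℓ u)) := by
  have hmem : firstIdx G d v ℓ u ∈ {i | i ≤ ℓ ∧ Reach G d u (v i)} ∪ {ℓ + 1} :=
    Nat.sInf_mem ⟨ℓ + 1, Or.inr rfl⟩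
  rcases hmem with hmem | hmem
  · exact hmem.2
  · rw [Set.mem_singleton_iff] at hmem
    omega

lemma firstIdx_anti {d e : ℝ} (hde : d ≤ e) (u : V) :
    firstIdx G e v ℓ u ≤ firstIdx G d v ℓ u := by
  rcases Nat.lt_or_ge ℓ (firstIdx G d v ℓ u) with h | h
  · exact (firstIdx_le_succ e u).trans h
  · exact firstIdx_le h ((reach_firstIdx h).mono hde)

end FirstIdx

/-! ### Core subpaths -/

section CoreSubpath

variable {V : Type*} {G : Digraph V} {D : ℝ} {v : ℕ → V} {ℓ : ℕ} {ρ : V → ℝ} {S : Finset V}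

lemma coreIdx_le_succ (u : V) : coreIdx G D v ℓ ρ u ≤ ℓ + 1 := firstIdx_le_succ _ u

lemma mem_pivotList {u : V} : u ∈ pivotList G D v ℓ ρ S ↔ u ∈ S := by
  simp [pivotList]

lemma pivotList_sorted :
    (pivotList G D v ℓ ρ S).Pairwise fun u w => coreIdx G D v ℓ ρ u ≤ coreIdx G D v ℓ ρ w := by
  have : Std.Total fun u w : V => coreIdx G D v ℓ ρ u ≤ coreIdx G D v ℓ ρ w :=
    ⟨fun _ _ => le_total _ _⟩
  have : IsTrans V fun u w : V => coreIdx G D v ℓ ρ u ≤ coreIdx G D v ℓ ρ w :=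
    ⟨fun _ _ _ => le_trans⟩
  exact List.pairwise_insertionSort _ _

lemma cutIdx_le_succ (i : ℕ) : cutIdx G D v ℓ ρ S i ≤ ℓ + 1 := by
  rcases i with _ | i
  · simp [cutIdx]
  · rcases h : (pivotList G D v ℓ ρ S)[i]? with _ | u
    · simp [cutIdx, h]
    · simpa [cutIdx, h] using coreIdx_le_succ u

lemma coreIdx_le_cutIdx {i k : ℕ} (hki : k < i) (hk : k < (pivotList G D v ℓ ρ S).length) :
    coreIdx G D v ℓ ρ (pivotList G D v ℓ ρ S)[k] ≤ cutIdx G D v ℓ ρ S i := by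
  obtain ⟨i, rfl⟩ : ∃ j, i = j + 1 := ⟨i - 1, by omega⟩
  rcases Nat.lt_or_ge i (pivotList G D v ℓ ρ S).length with hi | hi
  · rcases (Nat.le_of_lt_succ hki).eq_or_lt with rfl | hlt
    · simp [cutIdx, hi]
    · simpa [cutIdx, hi] using List.pairwise_iff_getElem.1 pivotList_sorted k i hk hi hlt
  · simpa [cutIdx, hi] using coreIdx_le_succ _

lemma foldr_min_le {l : List ℕ} {b : ℕ} : l.foldr min b ≤ b ∧ ∀ a ∈ l, l.foldr min b ≤ a := by
  induction l with
  | nil => simp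
  | cons c l ih =>
    refine ⟨(min_le_right _ _).trans ih.1, fun a ha => ?_⟩
    rcases List.mem_cons.1 ha with rfl | ha
    · exact min_le_left _ _
    · exact (min_le_right _ _).trans (ih.2 a ha)

lemma endIdx_le_succ (i : ℕ) : endIdx G D v ℓ ρ S i ≤ ℓ + 1 :=
  foldr_min_le.1.trans (cutIdx_le_succ _)

lemma endIdx_le_fringeIdx {i k : ℕ} (hik : i ≤ k) (hk : k < (pivotList G D v ℓ ρ S).length) :
    endIdx G D v ℓ ρ S i ≤ fringeIdx G D v ℓ ρ (pivotList G D v ℓ ρ S)[k] := by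
  refine foldr_min_le.2 _ (List.mem_map_of_mem ?_)
  rw [List.mem_drop_iff_getElem]
  exact ⟨k - i, by omega, by congr 1; omega⟩

/-- Every pivot comes either before or after the subpath `P_i` in the order of the pivots. -/
lemma coreIdx_le_cutIdx_or_endIdx_le_fringeIdx {u : V} (hu : u ∈ S) (i : ℕ) :
    coreIdx G D v ℓ ρ u ≤ cutIdx G D v ℓ ρ S i ∨
      endIdx G D v ℓ ρ S i ≤ fringeIdx G D v ℓ ρ u := by
  obtain ⟨k, hk, rfl⟩ := List.getElem_of_mem (mem_pivotList (G := G) (D := D) (v := v) (ℓ := ℓ)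
    (ρ := ρ).2 hu)
  rcases Nat.lt_or_ge k i with h | h
  · exact Or.inl (coreIdx_le_cutIdx h hk)
  · exact Or.inr (endIdx_le_fringeIdx h hk)

/-- From the core index of `u` on, every vertex of the path is within distance `ρ u * D` of `u`. -/
lemma reach_of_coreIdx_le (hv : IsWalk G v ℓ) (hℓ : (ℓ : ℝ) ≤ D) {u : V} {j : ℕ}
    (hj : j ≤ ℓ) (hu : coreIdx G D v ℓ ρ u ≤ j) : Reach G (ρ u * D) u (v j) :=
  ((reach_firstIdx (hu.trans hj)).trans (hv.reach hu hj)).mono (by linarith)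

/-- The vertices `x` of the core subproblem of `P_i` that reach `P_i` within distance `d` inside
it: the vertex set counted by `coreAncestorCount`, regarded as a subset of `V`. -/
def IsCoreAncestor (G : Digraph V) (D : ℝ) (v : ℕ → V) (ℓ : ℕ) (ρ : V → ℝ) (S : Finset V)
    (d : ℝ) (i : ℕ) (x : V) : Prop :=
  SameLabels G D ρ S x (v (cutIdx G D v ℓ ρ S i)) ∧ (∀ u ∈ S, ¬ IsBridge G D v ℓ ρ u) ∧
    ∃ j, cutIdx G D v ℓ ρ S i ≤ j ∧ j < endIdx G D v ℓ ρ S i ∧ Reach G d x (v j)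

open Classical in
lemma coreAncestorCount_le [Fintype V] (d : ℝ) (i : ℕ) :
    coreAncestorCount G D v ℓ ρ S d i ≤
      (Finset.univ.filter (IsCoreAncestor G D v ℓ ρ S d i)).card := by
  unfold coreAncestorCount
  refine Finset.card_le_card_of_injOn Subtype.val (fun x hx => ?_) Subtype.val_injective.injOn
  obtain ⟨y, ⟨hb, j, hcj, hje, hyj⟩, hxy⟩ := mem_ancestors.1 hx
  have hxj := hxy.of_induce
  rw [hyj] at hxj
  exact Finset.mem_coe.2 (Finset.mem_filter.2 ⟨Finset.mem_univ _, x.2, hb, j, hcj, hje, hxj⟩)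

lemma IsCoreAncestor.cutIdx_lt_endIdx {d : ℝ} {i : ℕ} {x : V}
    (h : IsCoreAncestor G D v ℓ ρ S d i x) :
    cutIdx G D v ℓ ρ S i < endIdx G D v ℓ ρ S i := by
  obtain ⟨-, -, j, h₁, h₂, -⟩ := h
  omega

lemma IsCoreAncestor.cutIdx_le {d : ℝ} {i : ℕ} {x : V} (h : IsCoreAncestor G D v ℓ ρ S d i x) :
    cutIdx G D v ℓ ρ S i ≤ ℓ :=
  Nat.le_of_lt_succ (h.cutIdx_lt_endIdx.trans_le (endIdx_le_succ i))

/-- For `i < j` with `P_i` and `P_j` nonempty, the pivot `u_j` reaches the first vertex of `P_j` but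
not that of `P_i`, so no vertex lies in both core subproblems. -/
lemma IsCoreAncestor.index_le (hv : IsWalk G v ℓ) (hℓ : (ℓ : ℝ) ≤ D) {d : ℝ} {i j : ℕ} {x : V}
    (hi : IsCoreAncestor G D v ℓ ρ S d i x) (hj : IsCoreAncestor G D v ℓ ρ S d j x) : j ≤ i := by
  by_contra! hij
  obtain ⟨k, rfl⟩ : ∃ k, j = k + 1 := ⟨j - 1, by omega⟩
  have hcut := hj.cutIdx_le
  have hk : k < (pivotList G D v ℓ ρ S).length := by
    by_contra! hk
    simp [cutIdx, hk] at hcut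
  set u := (pivotList G D v ℓ ρ S)[k] with hu
  have huS : u ∈ S := mem_pivotList.1 (List.getElem_mem hk)
  have h₁ : Reach G (ρ u * D) u (v (cutIdx G D v ℓ ρ S (k + 1))) :=
    reach_of_coreIdx_le hv hℓ hcut (coreIdx_le_cutIdx (Nat.lt_succ_self k) hk)
  have h₂ : Reach G (ρ u * D) u (v (cutIdx G D v ℓ ρ S i)) :=
    ((hi.1 u huS).1).1 (((hj.1 u huS).1).2 h₁)
  have h₃ : fringeIdx G D v ℓ ρ u ≤ cutIdx G D v ℓ ρ S i := firstIdx_le hi.cutIdx_le h₂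
  exact absurd hi.cutIdx_lt_endIdx
    (not_lt.2 ((endIdx_le_fringeIdx (Nat.le_of_lt_succ hij) hk).trans h₃))

/-- The condition that the pivot `z` with search scalar `r` imposes on an ancestor `x` of the path
(at distance at most `d`) for `x` to survive in a core subproblem: `z` must not be reached by `x`,
and must reach `x` if it meets the path no later than `x` does. -/
def Compatible (G : Digraph V) (D : ℝ) (v : ℕ → V) (ℓ : ℕ) (d : ℝ) (x z : V) (r : ℝ) : Prop :=
  ¬ Reach G (r * D) x z ∧
    (firstIdx G d v ℓ z ≤ firstIdx G d v ℓ x → Reach G (r * D) z x)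

/-- Here `x` may itself be a pivot. -/
lemma IsCoreAncestor.compatible (hv : IsWalk G v ℓ) (hℓ : (ℓ : ℝ) ≤ D)
    {d : ℝ} {i : ℕ} {x z : V} (hx : IsCoreAncestor G D v ℓ ρ S d i x) (hz : z ∈ S)
    (hzd : d ≤ (ρ z - 1) * D) (hzP : ∃ y ∈ pathVertices v ℓ, Reach G d z y) :
    Compatible G D v ℓ d x z (ρ z) := by
  have hd : d ≤ ρ z * D := by
    have : (0 : ℝ) ≤ ℓ := ℓ.cast_nonneg
    linarith
  have hcut := hx.cutIdx_le
  obtain ⟨hlab, hbr, j, hcj, hje, hxj⟩ := hx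
  refine ⟨fun h => ?_, fun h => ?_⟩
  · obtain ⟨y, ⟨k, hk, rfl⟩, hzk⟩ := hzP
    exact hbr z hz ⟨⟨k, hk, hzk.mono hd⟩, _, hcut, ((hlab z hz).2).1 h⟩
  · refine ((hlab z hz).1).2 (reach_of_coreIdx_le hv hℓ hcut ?_)
    refine (coreIdx_le_cutIdx_or_endIdx_le_fringeIdx hz i).resolve_right fun hf => ?_
    have h₁ : fringeIdx G D v ℓ ρ z ≤ firstIdx G d v ℓ z := firstIdx_anti hd z
    have h₂ : firstIdx G d v ℓ x ≤ j :=
      firstIdx_le (Nat.le_of_lt_succ (hje.trans_le (endIdx_le_succ i))) hxj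
    omega

/-- A pivot with nonnegative search distance carries its own labels, hence would be a bridge if it
survived in a core subproblem. -/
lemma IsCoreAncestor.notMem (hv : IsWalk G v ℓ) (hℓ : (ℓ : ℝ) ≤ D)
    {d : ℝ} {i : ℕ} {x : V} (hx : IsCoreAncestor G D v ℓ ρ S d i x)
    (hxd : x ∈ S → d ≤ (ρ x - 1) * D) : x ∉ S := by
  intro hxS
  have hend := endIdx_le_succ (G := G) (D := D) (v := v) (ℓ := ℓ) (ρ := ρ) (S := S) i
  obtain ⟨j, -, hje, hxj⟩ := hx.2.2
  refine (hx.compatible hv hℓ hxS (hxd hxS) ⟨v j, ⟨j, by omega, rfl⟩, hxj⟩).1 (Reach.refl ?_ x)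
  have : (0 : ℝ) ≤ ℓ := ℓ.cast_nonneg
  linarith [hxj.nonneg, hxd hxS]

open Classical in
lemma sum_coreAncestorCount_le [Fintype V] [DecidableEq V] (hv : IsWalk G v ℓ) (hℓ : (ℓ : ℝ) ≤ D) {d : ℝ}
    (hS : S ⊆ ancestors G d (pathVertices v ℓ)) (hd : ∀ u ∈ S, d ≤ (ρ u - 1) * D) (n : ℕ) :
    ∑ i ∈ Finset.range n, coreAncestorCount G D v ℓ ρ S d i ≤
      ((ancestors G d (pathVertices v ℓ) \ S).filter
        fun x => ∀ z ∈ S, Compatible G D v ℓ d x z (ρ z)).card := by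
  refine (Finset.sum_le_sum fun i _ => coreAncestorCount_le d i).trans ?_
  rw [← Finset.card_biUnion]
  · refine Finset.card_le_card fun x hx => ?_
    simp only [Finset.mem_biUnion, Finset.mem_filter, Finset.mem_univ, true_and] at hx
    obtain ⟨i, -, hx⟩ := hx
    have hend := endIdx_le_succ (G := G) (D := D) (v := v) (ℓ := ℓ) (ρ := ρ) (S := S) i
    obtain ⟨j, -, hje, hxj⟩ := hx.2.2
    simp only [Finset.mem_filter, Finset.mem_sdiff]
    exact ⟨⟨mem_ancestors.2 ⟨v j, ⟨j, by omega, rfl⟩, hxj⟩, hx.notMem hv hℓ (hd x)⟩,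
      fun z hz => hx.compatible hv hℓ hz (hd z hz) (mem_ancestors.1 (hS hz))⟩
  · intro i _ j _ hij
    rw [Function.onFun, Finset.disjoint_left]
    intro x hi hj
    simp only [Finset.mem_filter, Finset.mem_univ, true_and] at hi hj
    exact hij (le_antisymm (hj.index_le hv hℓ hi) (hi.index_le hv hℓ hj))

end CoreSubpath

/-! ### Two vertices are rarely compatible with each other -/

section Pairs

variable {V I : Type*} {G : Digraph V} {D : ℝ} {v : ℕ → V} {ℓ : ℕ}

open Classical in
/-- The distance `d(x, z)` is a threshold: off the one interval that contains `d(x, z) / D`, no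
interval scalar makes both search scalars of `x` reach `z` and those of `z` too short to do so. -/
lemma card_reach_add_card_not_reach_le [Fintype I] (hD : 0 < D) {lo hi : I → ℝ}
    (hdisj : Pairwise fun σ τ => Disjoint (Set.Ico (lo σ) (hi σ)) (Set.Ico (lo τ) (hi τ)))
    {a b : I → ℝ} (ha : ∀ σ, a σ ∈ Set.Ico (lo σ) (hi σ)) (hb : ∀ σ, b σ ∈ Set.Ico (lo σ) (hi σ))
    (x z : V) :
    (Finset.univ.filter fun σ => Reach G (a σ * D) x z).card +
      (Finset.univ.filter fun σ => ¬ Reach G (b σ * D) x z).card ≤ Fintype.card I + 1 := by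
  rw [← Finset.card_union_add_card_inter]
  refine add_le_add (Finset.card_le_univ _) (Finset.card_le_one.2 fun σ hσ τ hτ => ?_)
  simp only [Finset.mem_inter, Finset.mem_filter, Finset.mem_univ, true_and] at hσ hτ
  have hex : ∃ n : ℕ, ∃ p : ℕ → V, IsWalk G p n ∧ p 0 = x ∧ p n = z := by
    obtain ⟨⟨n, p, -, h⟩, -⟩ := hσ
    exact ⟨n, p, h⟩
  have key : ∀ σ, Reach G (a σ * D) x z → ¬ Reach G (b σ * D) x z →
      (Nat.find hex : ℝ) / D ∈ Set.Ico (lo σ) (hi σ) := by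
    intro σ h₁ h₂
    constructor
    · obtain ⟨p, hp⟩ := Nat.find_spec hex
      have : b σ * D < Nat.find hex := by
        by_contra! hle
        exact h₂ ⟨_, p, hle, hp⟩
      exact (hb σ).1.trans ((lt_div_iff₀ hD).2 this).le
    · obtain ⟨n, p, hn, hp⟩ := h₁
      have : (Nat.find hex : ℝ) ≤ n := by exact_mod_cast Nat.find_min' hex ⟨p, hp⟩
      exact ((div_le_iff₀ hD).2 (this.trans hn)).trans_lt (ha σ).2
  by_contra hne
  exact Set.disjoint_left.1 (hdisj hne) (key σ hσ.1 hσ.2) (key τ hτ.1 hτ.2)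

open Classical in
lemma card_compatible_add_card_compatible_le [Fintype I] (hD : 0 < D) {lo hi : I → ℝ}
    (hdisj : Pairwise fun σ τ => Disjoint (Set.Ico (lo σ) (hi σ)) (Set.Ico (lo τ) (hi τ)))
    {ρ : V → I → ℝ} (hρ : ∀ u σ, ρ u σ ∈ Set.Ico (lo σ) (hi σ)) (d : ℝ) (x z : V) :
    (Finset.univ.filter fun σ => Compatible G D v ℓ d x z (ρ z σ)).card +
      (Finset.univ.filter fun σ => Compatible G D v ℓ d z x (ρ x σ)).card ≤
        Fintype.card I + 1 := by
  wlog h : firstIdx G d v ℓ x ≤ firstIdx G d v ℓ z generalizing x z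
  · rw [add_comm]
    exact this z x (le_of_not_ge h)
  rw [add_comm]
  refine le_trans (add_le_add (Finset.card_le_card ?_) (Finset.card_le_card ?_))
    (card_reach_add_card_not_reach_le (G := G) hD hdisj (hρ x) (hρ z) x z)
  · exact Finset.monotone_filter_right _ fun σ _ hσ => hσ.2 h
  · exact Finset.monotone_filter_right _ fun σ _ hσ => hσ.1

end Pairs

/-! ### Averaging -/

section Averaging

/-- If `a = 1`, the left-hand side is at most the expected number of vertices of a random tournament
that beat all others, which is at most `1`. -/
lemma sum_prod_erase_le_pow {V : Type*} [DecidableEq V] {p : V → V → ℝ} {a : ℝ}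
    (hp : ∀ x z, 0 ≤ p x z) (hpa : ∀ x z, p x z + p z x ≤ a) (T : Finset V) (n : ℕ)
    (hT : T.card = n + 1) : ∑ x ∈ T, ∏ z ∈ T.erase x, p x z ≤ a ^ n := by
  induction n generalizing T with
  | zero =>
    obtain ⟨x, rfl⟩ := Finset.card_eq_one.1 hT
    simp
  | succ n ih =>
    obtain ⟨y, T, hy, rfl, hcard⟩ := Finset.card_eq_succ.1 hT
    obtain ⟨m, hm, hmax⟩ := T.exists_max_image (fun x => p x y) (Finset.card_pos.1 (by omega))
    rw [Finset.sum_insert hy, Finset.erase_insert hy]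
    -- With `m` maximizing `p m y`, the first product is at most `(a - p m y) * a ^ n`, and adding
    -- `y` multiplies each of the other products by at most `p m y`.
    have h₁ : ∏ z ∈ T, p y z ≤ (a - p m y) * a ^ n := by
      rw [← Finset.mul_prod_erase T _ hm]
      have hle : ∏ z ∈ T.erase m, p y z ≤ a ^ n := by
        have hc : (T.erase m).card = n := by rw [Finset.card_erase_of_mem hm]; omega
        calc ∏ z ∈ T.erase m, p y z ≤ ∏ _z ∈ T.erase m, a :=
              Finset.prod_le_prod (fun z _ => hp y z) fun z _ => by linarith [hpa y z, hp z y]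
          _ = a ^ n := by rw [Finset.prod_const, hc]
      exact mul_le_mul (by linarith [hpa y m]) hle (Finset.prod_nonneg fun z _ => hp y z)
        (by linarith [hpa y m, hp y m])
    have h₂ : ∑ x ∈ T, ∏ z ∈ (insert y T).erase x, p x z ≤ p m y * a ^ n := by
      refine le_trans ?_ (mul_le_mul_of_nonneg_left (ih T hcard) (hp m y))
      rw [Finset.mul_sum]
      refine Finset.sum_le_sum fun x hx => ?_
      have hxy : y ≠ x := fun h => hy (h ▸ hx)
      rw [Finset.erase_insert_of_ne hxy,
        Finset.prod_insert fun h => hy (Finset.mem_of_mem_erase h)]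
      exact mul_le_mul_of_nonneg_right (hmax x hx) (Finset.prod_nonneg fun z _ => hp x z)
    rw [pow_succ]
    linarith

/-- A `t`-set together with a point outside it is a `(t + 1)`-set with a distinguished point. -/
lemma sum_powersetCard_sum_sdiff {V : Type*} [DecidableEq V] (R : Finset V) (t : ℕ)
    (f : Finset V → V → ℝ) :
    ∑ S ∈ R.powersetCard t, ∑ x ∈ R \ S, f S x =
      ∑ T ∈ R.powersetCard (t + 1), ∑ x ∈ T, f (T.erase x) x := by
  rw [Finset.sum_sigma', Finset.sum_sigma']
  refine Finset.sum_bij' (fun q _ => ⟨insert q.2 q.1, q.2⟩) (fun q _ => ⟨q.1.erase q.2, q.2⟩)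
    ?_ ?_ ?_ ?_ ?_
  · rintro ⟨S, x⟩ h
    simp only [Finset.mem_sigma, Finset.mem_powersetCard, Finset.mem_sdiff] at h ⊢
    exact ⟨⟨Finset.insert_subset h.2.1 h.1.1, by rw [Finset.card_insert_of_notMem h.2.2, h.1.2]⟩,
      Finset.mem_insert_self _ _⟩
  · rintro ⟨T, x⟩ h
    simp only [Finset.mem_sigma, Finset.mem_powersetCard, Finset.mem_sdiff] at h ⊢
    exact ⟨⟨(Finset.erase_subset _ _).trans h.1.1,
      by rw [Finset.card_erase_of_mem h.2, h.1.2, Nat.add_sub_cancel]⟩,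
      h.1.1 h.2, Finset.notMem_erase _ _⟩
  · rintro ⟨S, x⟩ h
    simp only [Finset.mem_sigma, Finset.mem_sdiff] at h
    simp [Finset.erase_insert h.2.2]
  · rintro ⟨T, x⟩ h
    simp only [Finset.mem_sigma] at h
    simp [Finset.insert_erase h.2]
  · rintro ⟨S, x⟩ h
    simp only [Finset.mem_sigma, Finset.mem_sdiff] at h
    simp [Finset.erase_insert h.2.2]

/-- The coordinates of a uniformly random function are independent. -/
lemma expect_pi_ite_forall {V I : Type*} [Fintype V] [DecidableEq V] [Fintype I] [Nonempty I]
    (S : Finset V) (E : V → I → Prop) [∀ z, DecidablePred (E z)] :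
    (𝔼 σ : V → I, if ∀ z ∈ S, E z (σ z) then (1 : ℝ) else 0) =
      ∏ z ∈ S, ((Finset.univ.filter (E z)).card : ℝ) / Fintype.card I := by
  have hI : (Fintype.card I : ℝ) ≠ 0 := by exact_mod_cast Fintype.card_ne_zero
  have hset : (Finset.univ.filter fun σ : V → I => ∀ z ∈ S, E z (σ z)) =
      Fintype.piFinset fun z => if z ∈ S then Finset.univ.filter (E z) else Finset.univ := by
    ext σ
    simp only [Finset.mem_filter, Finset.mem_univ, true_and, Fintype.mem_piFinset]
    refine forall_congr' fun z => ?_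
    by_cases hz : z ∈ S <;> simp [hz]
  rw [Finset.expect_eq_sum_div_card, Finset.sum_boole, hset, Fintype.card_piFinset,
    Finset.card_univ, Fintype.card_fun, ← Finset.card_univ (α := V)]
  push_cast
  rw [← Finset.prod_const, ← Finset.prod_div_distrib, ← Finset.prod_filter_mul_prod_filter_not
    Finset.univ (· ∈ S)]
  rw [Finset.prod_eq_one (s := Finset.univ.filter (¬ · ∈ S)), mul_one, Finset.filter_univ_mem]
  · exact Finset.prod_congr rfl fun z hz => by simp [hz]
  · intro z hz
    have hz' : z ∉ S := by simpa using hz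
    simp [hz', hI]

lemma one_add_inv_pow_le {t n : ℕ} (h : 4 * t ≤ n) : (1 + 1 / (n : ℝ)) ^ t ≤ 1.5 := by
  have hexp : Real.exp (1 / 4) ≤ 1.5 := by
    have := Real.exp_bound_div_one_sub_of_interval (x := 1 / 4) (by norm_num) (by norm_num)
    norm_num at this ⊢
    linarith
  refine le_trans ?_ hexp
  rcases Nat.eq_zero_or_pos n with rfl | hn
  · obtain rfl : t = 0 := by omega
    simp
  have hn' : (0 : ℝ) < n := by exact_mod_cast hn
  have h' : 4 * (t : ℝ) ≤ n := by exact_mod_cast h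
  calc (1 + 1 / (n : ℝ)) ^ t ≤ Real.exp (1 / n) ^ t := by
        refine pow_le_pow_left₀ (by positivity) ?_ t
        linarith [Real.add_one_le_exp (1 / (n : ℝ))]
    _ = Real.exp (t * (1 / n)) := by rw [Real.exp_nat_mul]
    _ ≤ Real.exp (1 / 4) := by
        refine Real.exp_le_exp.2 ?_
        rw [mul_one_div, div_le_iff₀ hn']
        linarith

/-- The averaged form of `sum_prod_erase_le_pow`, over a random `t`-set `S` and the points
outside it. -/
lemma expect_powersetCard_sum_prod_le {V : Type*} [DecidableEq V] {p : V → V → ℝ} {a : ℝ}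
    (ha : 0 ≤ a) (hp : ∀ x z, 0 ≤ p x z) (hpa : ∀ x z, p x z + p z x ≤ a) (R : Finset V)
    {t : ℕ} (ht : t ≤ R.card) :
    𝔼 S ∈ R.powersetCard t, ∑ x ∈ R \ S, ∏ z ∈ S, p x z ≤ a ^ t / ((t : ℝ) + 1) * R.card := by
  rw [Finset.expect_eq_sum_div_card, Finset.card_powersetCard, sum_powersetCard_sum_sdiff]
  have hchoose : (0 : ℝ) < R.card.choose t := by exact_mod_cast Nat.choose_pos ht
  have hsucc : (R.card.choose (t + 1) : ℝ) * (t + 1) = R.card.choose t * (R.card - t : ℝ) := by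
    have := Nat.choose_succ_right_eq R.card t
    rw [← Nat.cast_sub ht]
    exact_mod_cast this
  have hsum : ∑ T ∈ R.powersetCard (t + 1), ∑ x ∈ T, ∏ z ∈ T.erase x, p x z ≤
      R.card.choose (t + 1) * a ^ t := by
    rw [← Finset.card_powersetCard, ← nsmul_eq_mul]
    exact Finset.sum_le_card_nsmul _ _ _ fun T hT =>
      sum_prod_erase_le_pow hp hpa T t (Finset.mem_powersetCard.1 hT).2
  have ht1 : (0 : ℝ) < (t : ℝ) + 1 := by positivity
  rw [div_le_iff₀ hchoose]
  refine hsum.trans ?_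
  have hN : (R.card.choose (t + 1) : ℝ) ≤ R.card.choose t * R.card / (t + 1) := by
    rw [le_div_iff₀ ht1, hsucc]
    exact mul_le_mul_of_nonneg_left (by linarith [t.cast_nonneg (α := ℝ)]) hchoose.le
  calc (R.card.choose (t + 1) : ℝ) * a ^ t ≤ R.card.choose t * R.card / (t + 1) * a ^ t :=
        mul_le_mul_of_nonneg_right hN (pow_nonneg ha t)
    _ = _ := by ring

open Classical in
/-- Exchanging sums and expectations, this bounds the expected number of core ancestors by the
average of a product over pairs. -/
lemma expect_sum_coreAncestorCount_le {V I : Type*} [Fintype V] [DecidableEq V]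
    [Fintype I] [Nonempty I] {G : Digraph V} {D : ℝ} {v : ℕ → V} {ℓ : ℕ} (hP : IsWalk G v ℓ)
    (hℓ : (ℓ : ℝ) ≤ D) {d : ℝ} {ρ : V → I → ℝ} (hd : ∀ u σ, d ≤ (ρ u σ - 1) * D)
    {S : Finset V} (hS : S ⊆ ancestors G d (pathVertices v ℓ)) (n : ℕ) :
    (𝔼 σ : V → I, ∑ i ∈ Finset.range n,
      (coreAncestorCount G D v ℓ (fun u => ρ u (σ u)) S d i : ℝ)) ≤
    ∑ x ∈ ancestors G d (pathVertices v ℓ) \ S, ∏ z ∈ S,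
      ((Finset.univ.filter fun s => Compatible G D v ℓ d x z (ρ z s)).card : ℝ) /
        Fintype.card I := by
  have hle : ∀ σ : V → I, ∑ i ∈ Finset.range n,
      (coreAncestorCount G D v ℓ (fun u => ρ u (σ u)) S d i : ℝ) ≤
        ∑ x ∈ ancestors G d (pathVertices v ℓ) \ S,
          if ∀ z ∈ S, Compatible G D v ℓ d x z (ρ z (σ z)) then (1 : ℝ) else 0 := by
    intro σ
    rw [Finset.sum_boole]
    have h := sum_coreAncestorCount_le (ρ := fun u => ρ u (σ u)) hP hℓ hS
      (fun u _ => hd u (σ u)) n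
    rw [← Nat.cast_sum]
    exact Nat.cast_le.2 h
  refine (Finset.expect_le_expect fun σ _ => hle σ).trans (le_of_eq ?_)
  rw [Finset.expect_sum_comm]
  refine Finset.sum_congr rfl fun x _ => ?_
  rw [← expect_pi_ite_forall S fun z s => Compatible G D v ℓ d x z (ρ z s)]

end Averaging

end DirectedHopset

theorem mainTheorem2 {V I : Type*} [Fintype V] [DecidableEq V] [Fintype I] [Nonempty I]
    (G : Digraph V) (D : ℝ) (hD : 0 < D)
    (v : ℕ → V) (ℓ : ℕ) (hP : DirectedHopset.IsWalk G v ℓ) (hℓ : (ℓ : ℝ) ≤ D)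
    (ρmin : ℝ)
    -- the interval with interval scalar `σ` is `[lo σ, hi σ)`
    (lo hi : I → ℝ) (hlo : ∀ σ, ρmin + 1 ≤ lo σ)
    (hdisj : Pairwise fun σ τ => Disjoint (Set.Ico (lo σ) (hi σ)) (Set.Ico (lo τ) (hi τ)))
    -- `ρ u σ` is the search scalar that `u` picks from its interval if its interval scalar is `σ`
    (ρ : V → I → ℝ) (hρ : ∀ u σ, ρ u σ ∈ Set.Ico (lo σ) (hi σ))
    (t : ℕ)
    (ht : t ≤ (DirectedHopset.ancestors G (ρmin * D)
      (DirectedHopset.pathVertices v ℓ)).card)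
    (hI : 4 * t ≤ Fintype.card I) :
    ∑ i ∈ Finset.range (t + 1),
      (𝔼 S ∈ (DirectedHopset.ancestors G (ρmin * D)
          (DirectedHopset.pathVertices v ℓ)).powersetCard t,
        𝔼 σ : V → I,
          (DirectedHopset.coreAncestorCount G D v ℓ (fun u => ρ u (σ u)) S (ρmin * D) i : ℝ))
      ≤ 1.5 / ((t : ℝ) + 1) *
        ((DirectedHopset.ancestors G (ρmin * D)
          (DirectedHopset.pathVertices v ℓ)).card : ℝ) := by
  classical
  have hcard : (0 : ℝ) < Fintype.card I := by exact_mod_cast Fintype.card_pos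
  have hd : ∀ u σ, ρmin * D ≤ (ρ u σ - 1) * D := fun u σ =>
    mul_le_mul_of_nonneg_right (by linarith [hlo σ, (hρ u σ).1]) hD.le
  set R := DirectedHopset.ancestors G (ρmin * D) (DirectedHopset.pathVertices v ℓ)
  rw [← Finset.expect_sum_comm]
  simp_rw [← Finset.expect_sum_comm]
  refine (Finset.expect_le_expect fun S hS =>
    DirectedHopset.expect_sum_coreAncestorCount_le hP hℓ hd
      (Finset.mem_powersetCard.1 hS).1 (t + 1)).trans ?_
  refine (DirectedHopset.expect_powersetCard_sum_prod_le
    (a := 1 + 1 / (Fintype.card I : ℝ)) (by positivity) (fun x z => by positivity)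
    (fun x z => ?_) R ht).trans ?_
  · rw [← add_div, div_le_iff₀ hcard, add_mul, one_div_mul_cancel hcard.ne', one_mul]
    exact_mod_cast DirectedHopset.card_compatible_add_card_compatible_le hD hdisj hρ _ x z
  · gcongr
    exact DirectedHopset.one_add_inv_pow_le hI
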